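/- Let $(\Omega,d)$ be a compact metric space and let $\alpha,\beta$ be finite non-negative Borel measures on $\Omega$, with total masses $m_\alpha=\alpha(\Omega)$, $m_\beta=\beta(\Omega)$. For $m\ge 0$ let $\Gamma_m(\alpha,\beta)$ be the set of non-negative measures $\pi$ on $\Omega\times\Omega$ with $\pi(A\times\Omega)\le\alpha(A)$ and $\pi(\Omega\times A)\le\beta(A)$ for all measurable $A\subseteq\Omega$ and $\pi(\Omega\times\Omega)\ge m$, and let $$\mathcal L_{M,m}(\alpha,\beta)=\inf_{\pi\in\Gamma_m(\alpha,\beta)}\int_{\Omega\times\Omega}d(x,y)\,d\pi(x,y)\in[0,\infty]\qquad(\inf\emptyset=+\infty).$$ (1) One has $$\mathcal L_{M,m}(\alpha,\beta)=\sup\Big\{\int_\Omega f\,d\alpha-\int_\Omega f\,d\beta+h\,(m-m_\beta)\;:\; f:\Omega\to\mathbb R\text{ is 1-Lipschitz},\ h\ge 0,\ -h\le f\le 0\Big\}.\qquad(*)$$ If moreover $m\le\min(m_\alpha,m_\beta)$, then this value is finite and also equals $$\sup\Big\{\int_\Omega f\,d\alpha-\int_\Omega f\,d\beta-(\inf f)(m-m_\beta)\;:\;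 f \text{ is 1-Lipschitz},\ f\le 0\Big\}$$ (for $\Omega=\emptyset$, $\inf f$ is read as $0$). (2) If $m\le\min(m_\alpha,m_\beta)$, then $(*)$ has a maximizer $(f^*,h)$, and it can be chosen with $h=-\inf f^*$. (3) Let $\Omega'$ be a compact metric space, let $\beta$ now be a finite non-negative Borel measure on $\Omega'$ with total mass $m_\beta$, let $0\le m\le\min(m_\alpha,m_\beta)$, and let $T_\theta:\Omega'\to\Omega$, $\theta\in\mathbb R^p$, be a family of maps such that every $\tilde\theta\in\mathbb R^p$ has a neighbourhood $U$ and a constant $\Delta(\tilde\theta)$ with $$d\big(T_\theta(y_1),T_{\theta'}(y_2)\big)\le\Delta(\tilde\theta)\big(\|\theta-\theta'\|+d(y_1,y_2)\big)\qquad\text{for all }\theta,\theta'\in U,\ y_1,y_2\in\Omega'.$$ Put $\beta_\theta=(T_\theta)_\#\beta$. Then $\theta\mapsto\mathcal L_{M,m}(\alpha,\beta_\theta)$ is continuous, indeed locally Lipschitz, and it is differentiable at Lebesgue-almost every $\theta$. Moreover, if at a point $\theta$ this function is differentiable, $(f^*,h)$ is any maximizer of $(*)$ for the pair $(\alpha,\beta_\theta)$,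 and for $\beta$-almost every $y$ the function $\vartheta\mapsto f^*(T_\vartheta(y))$ is differentiable at $\vartheta=\theta$, then $y\mapsto\nabla_\theta(f^*\circ T_\theta)(y)$ is $\beta$-integrable and $$\nabla_\theta\mathcal L_{M,m}(\alpha,\beta_\theta)=-\int_{\Omega'}\nabla_\theta\,(f^*\circ T_\theta)(y)\,d\beta(y).$$ -/

import Mathlib

open MeasureTheory Topology
open scoped ENNReal

namespace PartialWasserstein

/-- The set `Γ_m(α, β)` of partial transport plans of mass at least `m`: nonnegative measures on
`Ω × Ω` whose marginals are dominated by `α` and `β`. -/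
def plans {Ω : Type*} [MeasurableSpace Ω] (m : ℝ) (α β : Measure Ω) : Set (Measure (Ω × Ω)) :=
  {π | (∀ A : Set Ω, MeasurableSet A → π (A ×ˢ Set.univ) ≤ α A) ∧
    (∀ A : Set Ω, MeasurableSet A → π (Set.univ ×ˢ A) ≤ β A) ∧
    ENNReal.ofReal m ≤ π Set.univ}

/-- The partial-mass Wasserstein-1 discrepancy `𝓛_{M,m}(α, β)`, the infimum of the transport cost
over `Γ_m(α, β)` (`∞` when there is no plan). -/
noncomputable def discrepancy {Ω : Type*} [MetricSpace Ω] [MeasurableSpace Ω]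
    (m : ℝ) (α β : Measure Ω) : ℝ≥0∞ :=
  ⨅ π ∈ plans m α β, ∫⁻ z, edist z.1 z.2 ∂π

/-- Admissible pairs: `f` is 1-Lipschitz, `h ≥ 0` and `-h ≤ f ≤ 0`. -/
def Admissible {Ω : Type*} [MetricSpace Ω] (f : Ω → ℝ) (h : ℝ) : Prop :=
  LipschitzWith 1 f ∧ 0 ≤ h ∧ ∀ x, -h ≤ f x ∧ f x ≤ 0

/-- The Kantorovich-Rubinstein functional `∫ f d(α - β) + h (m - m_β)`. -/
noncomputable def functional {Ω : Type*} [MeasurableSpace Ω]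
    (m : ℝ) (α β : Measure Ω) (f : Ω → ℝ) (h : ℝ) : ℝ :=
  (∫ x, f x ∂α) - (∫ x, f x ∂β) + h * (m - β.real Set.univ)

/-- `(f, h)` is a maximizer of the Kantorovich-Rubinstein functional over admissible pairs. -/
def IsMaximizer {Ω : Type*} [MetricSpace Ω] [MeasurableSpace Ω]
    (m : ℝ) (α β : Measure Ω) (f : Ω → ℝ) (h : ℝ) : Prop :=
  Admissible f h ∧
    ∀ (g : Ω → ℝ) (k : ℝ), Admissible g k → functional m α β g k ≤ functional m α β f h

/-- The regularity assumption on a parametrized family of maps `T θ : Ω' → Ω`: joint Lipschitz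
continuity in `(θ, y)`, locally in `θ` and uniformly in `y`. -/
def LocallyJointlyLipschitz {p : ℕ} {Ω Ω' : Type*} [MetricSpace Ω] [MetricSpace Ω']
    (T : EuclideanSpace ℝ (Fin p) → Ω' → Ω) : Prop :=
  ∀ θ₀, ∃ U ∈ 𝓝 θ₀, ∃ Δ : ℝ, ∀ θ ∈ U, ∀ θ' ∈ U, ∀ y₁ y₂ : Ω',
    dist (T θ y₁) (T θ' y₂) ≤ Δ * (‖θ - θ'‖ + dist y₂ y₁)

/-- The objective `θ ↦ 𝓛_{M,m}(α, β_θ)`, where `β_θ` is the push-forward of `β` by `T θ`. -/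
noncomputable def objective {p : ℕ} {Ω Ω' : Type*} [MetricSpace Ω] [MeasurableSpace Ω]
    [MeasurableSpace Ω'] (m : ℝ) (α : Measure Ω) (β : Measure Ω')
    (T : EuclideanSpace ℝ (Fin p) → Ω' → Ω) (θ : EuclideanSpace ℝ (Fin p)) : ℝ :=
  (discrepancy m α (β.map (T θ))).toReal

end PartialWasserstein

/-!
Everything rests on Kantorovich duality for partial transport with cost `d`.

The dual functional is bounded by the cost of any plan (`functional_le_integral_dist`): integrating
the nonpositive `f` against the first marginal of a plan instead of `α`, and the nonnegative `f + h`
against the second marginal instead of `β`, can only help, and `f x - f y ≤ d (x, y)`.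

Conversely, every upper bound `D` of the dual functional admits a plan of cost at most `D`
(`exists_plan_of_functional_le`). A plan is sought as a positive linear functional on `C(Ω × Ω)`,
and its constraints (marginals, mass, cost) are linear inequalities. The M. Riesz extension theorem
solves such a system as soon as no nonnegative combination of the constraints is contradictory,
and the Riesz–Markov–Kakutani theorem turns the solution into a measure. A combination is, up to
scaling, a triple `φ, ψ ≥ 0`, `h ≥ 0` with `h ≤ φ x + ψ y + d (x, y)`; a single sup-convolution
replaces it by an admissible pair `(f, h)` that is at least as good (`le_of_feasible`), so `D` bounds
its value `h m - ∫ φ dα - ∫ ψ dβ`. This argument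
needs no relation between `m`, `m_α` and `m_β`: if no plan exists, then no real bound `D` exists.

When `m ≤ m_β`, decreasing `h` to `-inf f` improves the functional, and when also `m ≤ m_α`,
translating `f` up until `sup f = 0` improves it too. After that `h` is at most the diameter, and
a maximizer exists by the Arzelà–Ascoli theorem (`exists_isMaximizer`).

For the parametric part the objective is thus a pointwise maximum of the functions
`θ ↦ ∫ f dα - ∫ f (T θ y) dβ(y) + h (m - m_β)`, which are Lipschitz near each point with a constant
independent of `(f, h)`. So is the objective, and Rademacher's theorem applies locally. A maximizer
at `θ` gives such a function touching the objective from below at `θ`, so the gradients agree,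
and the gradient is computed under the integral sign by dominated convergence.
-/

namespace PartialWasserstein

/-! ### Comparing finite measures through continuous functions -/

/-- A finite measure on a metric space is dominated by another as soon as it is dominated on
nonnegative bounded continuous functions: approximate closed sets by thickened indicators, then
measurable sets by closed ones. -/
theorem measure_le_of_integral_le {X : Type*} [MetricSpace X] [MeasurableSpace X] [BorelSpace X]
    (μ ν : Measure X) [IsFiniteMeasure μ] [IsFiniteMeasure ν]
    (h : ∀ φ : C(X, ℝ), (∀ x, 0 ≤ φ x) → ∫ x, φ x ∂μ ≤ ∫ x, φ x ∂ν) : μ ≤ ν := by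
  have hclosed : ∀ F : Set X, IsClosed F → μ F ≤ ν F := by
    intro F hF
    have hpos : ∀ n : ℕ, (0 : ℝ) < 1 / ((n : ℝ) + 1) := fun n => by positivity
    refine le_of_tendsto_of_tendsto'
      (tendsto_lintegral_thickenedIndicator_of_isClosed μ hF hpos
        tendsto_one_div_add_atTop_nhds_zero_nat)
      (tendsto_lintegral_thickenedIndicator_of_isClosed ν hF hpos
        tendsto_one_div_add_atTop_nhds_zero_nat) fun n => ?_
    have key := h ⟨fun x => (thickenedIndicator (hpos n) F x : ℝ), by fun_prop⟩
      (fun x => NNReal.coe_nonneg _)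
    have conv : ∀ ρ : Measure X, IsFiniteMeasure ρ →
        ∫⁻ x, (thickenedIndicator (hpos n) F x : ℝ≥0∞) ∂ρ
          = ENNReal.ofReal (∫ x, (thickenedIndicator (hpos n) F x : ℝ) ∂ρ) := by
      intro ρ _
      rw [ofReal_integral_eq_lintegral_ofReal (integrable_thickenedIndicator F (hpos n))
        (Filter.Eventually.of_forall fun x => NNReal.coe_nonneg _)]
      simp
    rw [conv μ inferInstance, conv ν inferInstance]
    exact ENNReal.ofReal_le_ofReal key
  refine Measure.le_iff.2 fun A hA => ?_
  rw [hA.measure_eq_iSup_isClosed_of_ne_top (measure_ne_top μ A)]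
  exact iSup_le fun K => iSup_le fun hK => iSup_le fun hKc =>
    (hclosed K hKc).trans (measure_mono hK)

theorem _root_.Continuous.integrable_of_compactSpace {X : Type*} [TopologicalSpace X]
    [CompactSpace X] [MeasurableSpace X] [OpensMeasurableSpace X] {μ : Measure X}
    [IsFiniteMeasure μ] {f : X → ℝ} (hf : Continuous f) : Integrable f μ :=
  hf.integrable_of_hasCompactSupport (HasCompactSupport.of_compactSpace f)

/-! ### Weak duality -/

theorem isFiniteMeasure_of_mem_plans {Ω : Type*} [MeasurableSpace Ω] {α β : Measure Ω}
    [IsFiniteMeasure α] {m : ℝ} {π : Measure (Ω × Ω)} (hπ : π ∈ plans m α β) :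
    IsFiniteMeasure π :=
  ⟨by simpa using (hπ.1 Set.univ MeasurableSet.univ).trans_lt (measure_lt_top α _)⟩

section Duality

variable {Ω : Type*} [MetricSpace Ω] [CompactSpace Ω] [MeasurableSpace Ω] [BorelSpace Ω]

theorem functional_le_integral_dist {α β : Measure Ω} [IsFiniteMeasure α] [IsFiniteMeasure β]
    {π : Measure (Ω × Ω)} [IsFiniteMeasure π] {m : ℝ} {f : Ω → ℝ} {h : ℝ}
    (hfst : π.map Prod.fst ≤ α) (hsnd : π.map Prod.snd ≤ β) (hmass : m ≤ π.real Set.univ)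
    (hf : Admissible f h) : functional m α β f h ≤ ∫ z, dist z.1 z.2 ∂π := by
  obtain ⟨hlip, hh, hb⟩ := hf
  have hc : Continuous f := hlip.continuous
  -- both inequalities below compare integrals of nonnegative functions: `-f` and `f + h`
  have h1 : ∫ x, f x ∂α ≤ ∫ z, f z.1 ∂π := by
    have := integral_mono_measure (f := fun x => -f x) hfst
      (Filter.Eventually.of_forall fun x => by simpa using (hb x).2)
      hc.neg.integrable_of_compactSpace
    rw [integral_neg, integral_neg, integral_map measurable_fst.aemeasurable
      hc.aestronglyMeasurable] at this
    linarith
  have h2 : ∫ z, (f z.2 + h) ∂π ≤ ∫ x, (f x + h) ∂β := by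
    have hc' : Continuous fun x => f x + h := by fun_prop
    have := integral_mono_measure (f := fun x => f x + h) hsnd
      (Filter.Eventually.of_forall fun x => by simpa using (by linarith [(hb x).1] : 0 ≤ f x + h))
      hc'.integrable_of_compactSpace
    rwa [integral_map measurable_snd.aemeasurable hc'.aestronglyMeasurable] at this
  have hi1 : Integrable (fun z : Ω × Ω => f z.1) π :=
    (hc.comp continuous_fst).integrable_of_compactSpace
  have hi2 : Integrable (fun z : Ω × Ω => f z.2) π :=
    (hc.comp continuous_snd).integrable_of_compactSpace
  have h3 : ∫ z, (f z.1 - f z.2) ∂π ≤ ∫ z, dist z.1 z.2 ∂π :=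
    integral_mono (hi1.sub hi2) continuous_dist.integrable_of_compactSpace fun z => by
      have := hlip.dist_le_mul z.1 z.2
      rw [NNReal.coe_one, one_mul, Real.dist_eq] at this
      exact (le_abs_self _).trans this
  rw [integral_sub hi1 hi2] at h3
  rw [integral_add hi2 (integrable_const _),
    integral_add hc.integrable_of_compactSpace (integrable_const _), integral_const,
    integral_const, smul_eq_mul, smul_eq_mul] at h2
  have h4 : h * m ≤ h * π.real Set.univ := mul_le_mul_of_nonneg_left hmass hh
  unfold functional
  linarith

theorem lintegral_edist_eq_ofReal_integral (π : Measure (Ω × Ω)) [IsFiniteMeasure π] :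
    ∫⁻ z, edist z.1 z.2 ∂π = ENNReal.ofReal (∫ z, dist z.1 z.2 ∂π) := by
  rw [ofReal_integral_eq_lintegral_ofReal continuous_dist.integrable_of_compactSpace
    (Filter.Eventually.of_forall fun z => dist_nonneg)]
  simp only [edist_dist]

theorem functional_le_discrepancy {α β : Measure Ω} [IsFiniteMeasure α] [IsFiniteMeasure β]
    {m : ℝ} {f : Ω → ℝ} {h : ℝ} (hf : Admissible f h) :
    ((functional m α β f h : ℝ) : EReal) ≤ ((discrepancy m α β : ℝ≥0∞) : EReal) := by
  have key : ENNReal.ofReal (functional m α β f h) ≤ discrepancy m α β := by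
    refine le_iInf₂ fun π hπ => ?_
    have := isFiniteMeasure_of_mem_plans hπ
    rw [lintegral_edist_eq_ofReal_integral π]
    refine ENNReal.ofReal_le_ofReal (functional_le_integral_dist ?_ ?_ ?_ hf)
    · refine Measure.le_iff.2 fun A hA => ?_
      rw [Measure.map_apply measurable_fst hA, ← Set.prod_univ]
      exact hπ.1 A hA
    · refine Measure.le_iff.2 fun A hA => ?_
      rw [Measure.map_apply measurable_snd hA, ← Set.univ_prod]
      exact hπ.2.1 A hA
    · exact (ENNReal.ofReal_le_iff_le_toReal (measure_ne_top π _)).1 hπ.2.2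
  refine le_trans ?_ (EReal.coe_ennreal_le_coe_ennreal_iff.2 key)
  rw [EReal.coe_ennreal_ofReal]
  exact EReal.coe_le_coe_iff.2 (le_max_left _ _)

/-! ### Strong duality -/

/-- The separation step of the duality: a cone of prescribed bounds `(u, r)` that reaches every `u`
and has no negative bound for `u = 0` is respected by some linear functional. -/
theorem exists_linearMap_le_of_cone {E : Type*} [AddCommGroup E] [Module ℝ E]
    (S : PointedCone ℝ (E × ℝ)) (h0 : ∀ r : ℝ, ((0 : E), r) ∈ S → 0 ≤ r)
    (hS : ∀ u : E, ∃ r : ℝ, (u, r) ∈ S) :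
    ∃ g : E →ₗ[ℝ] ℝ, ∀ u r, (u, r) ∈ S → g u ≤ r := by
  let f : (E × ℝ) →ₗ.[ℝ] ℝ :=
    ⟨Submodule.prod ⊥ ⊤, (LinearMap.snd ℝ E ℝ).comp (Submodule.subtype _)⟩
  obtain ⟨G, hG, hGS⟩ := riesz_extension S f
    (by
      rintro ⟨⟨u, r⟩, hu⟩ hx
      obtain rfl : u = 0 := by simpa [f] using hu
      exact h0 r hx)
    (by
      rintro ⟨u, t⟩
      obtain ⟨r, hr⟩ := hS u
      exact ⟨⟨(0, r - t), by simp [f]⟩, by simpa using hr⟩)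
  refine ⟨-(G.comp (LinearMap.inl ℝ E ℝ)), fun u r hur => ?_⟩
  have h1 : G (0, r) = r := hG ⟨(0, r), by simp [f]⟩
  have h2 := hGS _ hur
  have h3 : G (u, r) = G (u, 0) + G (0, r) := by rw [← map_add]; simp
  simp only [LinearMap.neg_apply, LinearMap.comp_apply, LinearMap.inl_apply]
  linarith

/-- Any feasible triple `(φ, ψ, h)` of the linear programming dual is no better than the
admissible pair `(f, h)`, where `f x = sup_z max (-h) (-φ z - d (x, z))`. -/
theorem le_of_feasible {α β : Measure Ω} [IsFiniteMeasure α] [IsFiniteMeasure β] {m D : ℝ}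
    (hD : ∀ (f : Ω → ℝ) (h : ℝ), Admissible f h → functional m α β f h ≤ D)
    {φ ψ : C(Ω, ℝ)} {h : ℝ} (hφ : ∀ x, 0 ≤ φ x) (hψ : ∀ x, 0 ≤ ψ x) (hh : 0 ≤ h)
    (hle : ∀ x y, h ≤ φ x + ψ y + dist x y) :
    h * m - ∫ x, φ x ∂α - ∫ x, ψ x ∂β ≤ D := by
  let F : Ω → Ω → ℝ := fun x z => max (-h) (-φ z - dist x z)
  let f : Ω → ℝ := fun x => ⨆ z, F x z
  have hF0 : ∀ x z, F x z ≤ 0 := fun x z =>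
    max_le (by linarith) (by linarith [hφ z, dist_nonneg (x := x) (y := z)])
  have hbdd : ∀ x, BddAbove (Set.range (F x)) := fun x => ⟨0, by rintro _ ⟨z, rfl⟩; exact hF0 x z⟩
  have hFf : ∀ x z, F x z ≤ f x := fun x z => le_ciSup (hbdd x) z
  have hlip : LipschitzWith 1 f := by
    refine LipschitzWith.of_le_add fun x y => ?_
    have : Nonempty Ω := ⟨x⟩
    refine ciSup_le fun z => max_le ?_ ?_
    · have := (le_max_left _ _).trans (hFf y z)
      linarith [dist_nonneg (x := x) (y := y)]
    · have := (le_max_right _ _).trans (hFf y z)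
      linarith [dist_triangle_left y z x]
  have hφf : ∀ x, -φ x ≤ f x := fun x => by
    simpa using (le_max_right _ _).trans (hFf x x)
  have hfψ : ∀ x, f x ≤ ψ x - h := fun x => by
    have : Nonempty Ω := ⟨x⟩
    refine ciSup_le fun z => max_le ?_ ?_
    · linarith [hψ x]
    · linarith [hle z x, dist_comm x z]
  have hadm : Admissible f h := ⟨hlip, hh, fun x => ⟨(le_max_left _ _).trans (hFf x x), by
    have : Nonempty Ω := ⟨x⟩
    exact ciSup_le (hF0 x)⟩⟩
  have h1 : ∫ x, -φ x ∂α ≤ ∫ x, f x ∂α :=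
    integral_mono φ.continuous.neg.integrable_of_compactSpace
      hlip.continuous.integrable_of_compactSpace hφf
  have h2 : ∫ x, f x ∂β ≤ ∫ x, (ψ x - h) ∂β :=
    integral_mono hlip.continuous.integrable_of_compactSpace
      (ψ.continuous.sub continuous_const).integrable_of_compactSpace hfψ
  rw [integral_neg] at h1
  rw [integral_sub ψ.continuous.integrable_of_compactSpace (integrable_const _), integral_const,
    smul_eq_mul] at h2
  have := hD f h hadm
  unfold functional at this
  linarith

/-- The bound of `le_of_feasible` in homogeneous form, with a multiple `l` of the cost. -/
theorem le_mul_of_feasible {α β : Measure Ω} [IsFiniteMeasure α] [IsFiniteMeasure β] {m D : ℝ}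
    (hD : ∀ (f : Ω → ℝ) (h : ℝ), Admissible f h → functional m α β f h ≤ D)
    {φ ψ : C(Ω, ℝ)} {h l : ℝ} (hφ : ∀ x, 0 ≤ φ x) (hψ : ∀ x, 0 ≤ ψ x) (hh : 0 ≤ h) (hl : 0 ≤ l)
    (hle : ∀ x y, h ≤ φ x + ψ y + l * dist x y) :
    h * m - ∫ x, φ x ∂α - ∫ x, ψ x ∂β ≤ l * D := by
  -- enlarging `l` makes it positive, hence invertible; let it decrease to `l` afterwards
  have key : ∀ k ∈ Set.Ioi l, h * m - ∫ x, φ x ∂α - ∫ x, ψ x ∂β ≤ k * D := by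
    intro k hk
    have hk0 : 0 < k := hl.trans_lt hk
    have := le_of_feasible hD (φ := k⁻¹ • φ) (ψ := k⁻¹ • ψ) (h := k⁻¹ * h)
      (fun x => mul_nonneg (inv_nonneg.2 hk0.le) (hφ x))
      (fun x => mul_nonneg (inv_nonneg.2 hk0.le) (hψ x)) (mul_nonneg (inv_nonneg.2 hk0.le) hh)
      (fun x y => by
        have h1 : h ≤ φ x + ψ y + k * dist x y :=
          (hle x y).trans (by have := mul_le_mul_of_nonneg_right (le_of_lt hk)
                                (dist_nonneg (x := x) (y := y)); linarith)
        have h2 := mul_le_mul_of_nonneg_left h1 (inv_nonneg.2 hk0.le)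
        simp only [ContinuousMap.coe_smul, Pi.smul_apply, smul_eq_mul]
        rw [mul_add, mul_add, inv_mul_cancel_left₀ hk0.ne'] at h2
        exact h2)
    simp only [ContinuousMap.coe_smul, Pi.smul_apply, smul_eq_mul, integral_const_mul] at this
    have h3 := mul_le_mul_of_nonneg_left this hk0.le
    have h4 : k * (k⁻¹ * h * m - k⁻¹ * ∫ x, φ x ∂α - k⁻¹ * ∫ x, ψ x ∂β)
        = h * m - ∫ x, φ x ∂α - ∫ x, ψ x ∂β := by field_simp
    rwa [h4] at h3
  refine ge_of_tendsto (x := 𝓝[>] l) (f := fun k => k * D) ?_ ?_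
  · exact ((continuous_id.mul continuous_const).tendsto l).mono_left nhdsWithin_le_nhds
  · exact Filter.mem_of_superset self_mem_nhdsWithin key

/-- The cone of pairs `(u, r)` for which some combination of the constraints of the partial
transport problem shows that every plan `π` of cost at most `D` satisfies `∫ u dπ ≤ r`. -/
def boundCone (m D : ℝ) (α β : Measure Ω) [IsFiniteMeasure α] [IsFiniteMeasure β] :
    PointedCone ℝ (C(Ω × Ω, ℝ) × ℝ) where
  carrier := {p | ∃ (φ ψ : C(Ω, ℝ)) (h l : ℝ), (∀ x, 0 ≤ φ x) ∧ (∀ x, 0 ≤ ψ x) ∧ 0 ≤ h ∧ 0 ≤ l ∧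
    (∀ x y, p.1 (x, y) ≤ φ x + ψ y - h + l * dist x y) ∧
    ∫ x, φ x ∂α + ∫ x, ψ x ∂β - h * m + l * D ≤ p.2}
  zero_mem' := ⟨0, 0, 0, 0, by simp⟩
  add_mem' := by
    rintro p q ⟨φ, ψ, h, l, h1, h2, h3, h4, h5, h6⟩ ⟨φ', ψ', h', l', h1', h2', h3', h4', h5', h6'⟩
    refine ⟨φ + φ', ψ + ψ', h + h', l + l', fun x => add_nonneg (h1 x) (h1' x),
      fun x => add_nonneg (h2 x) (h2' x), add_nonneg h3 h3', add_nonneg h4 h4',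
      fun x y => ?_, ?_⟩
    · simp only [Prod.fst_add, ContinuousMap.add_apply]
      linarith [h5 x y, h5' x y]
    · simp only [Prod.snd_add, ContinuousMap.add_apply]
      rw [integral_add φ.continuous.integrable_of_compactSpace
        φ'.continuous.integrable_of_compactSpace, integral_add
        ψ.continuous.integrable_of_compactSpace ψ'.continuous.integrable_of_compactSpace]
      linarith
  smul_mem' := by
    rintro ⟨c, hc⟩ p ⟨φ, ψ, h, l, h1, h2, h3, h4, h5, h6⟩
    refine ⟨c • φ, c • ψ, c * h, c * l, fun x => mul_nonneg hc (h1 x),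
      fun x => mul_nonneg hc (h2 x), mul_nonneg hc h3, mul_nonneg hc h4, fun x y => ?_, ?_⟩
    · have := mul_le_mul_of_nonneg_left (h5 x y) hc
      change c * p.1 (x, y) ≤ c * φ x + c * ψ y - c * h + c * l * dist x y
      linarith
    · have := mul_le_mul_of_nonneg_left h6 hc
      change ∫ x, c * φ x ∂α + ∫ x, c * ψ x ∂β - c * h * m + c * l * D ≤ c * p.2
      rw [integral_const_mul, integral_const_mul]
      linarith

theorem exists_measure_integral_eq {X : Type*} [TopologicalSpace X] [CompactSpace X] [T2Space X]
    [MeasurableSpace X] [BorelSpace X] (g : C(X, ℝ) →ₗ[ℝ] ℝ)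
    (hg : ∀ u : C(X, ℝ), (∀ x, 0 ≤ u x) → 0 ≤ g u) :
    ∃ π : Measure X, IsFiniteMeasure π ∧ ∀ u : C(X, ℝ), ∫ x, u x ∂π = g u := by
  let L : CompactlySupportedContinuousMap X ℝ →ₗ[ℝ] ℝ :=
    { toFun := fun u => g u.toContinuousMap
      map_add' := fun u v => g.map_add u.toContinuousMap v.toContinuousMap
      map_smul' := fun c u => g.map_smul c u.toContinuousMap }
  let Λ := PositiveLinearMap.mk₀ L fun u hu => hg _ hu
  exact ⟨RealRMK.rieszMeasure Λ, inferInstance, fun u => RealRMK.integral_rieszMeasure Λ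
    (CompactlySupportedContinuousMap.continuousMapEquiv u)⟩

/-- Strong duality: an upper bound `D` of the dual problem bounds the cost of some partial transport
plan. Nothing is assumed about `m`: that a plan exists follows from the finiteness of `D`. -/
theorem exists_plan_of_functional_le {α β : Measure Ω} [IsFiniteMeasure α] [IsFiniteMeasure β]
    {m D : ℝ} (hD : ∀ (f : Ω → ℝ) (h : ℝ), Admissible f h → functional m α β f h ≤ D) :
    ∃ π ∈ plans m α β, ∫⁻ z, edist z.1 z.2 ∂π ≤ ENNReal.ofReal D := by
  obtain ⟨g, hg⟩ := exists_linearMap_le_of_cone (boundCone m D α β)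
    (by
      rintro r ⟨φ, ψ, h, l, h1, h2, h3, h4, h5, h6⟩
      have := le_mul_of_feasible hD h1 h2 h3 h4 fun x y => by
        have := h5 x y
        simp only [ContinuousMap.zero_apply] at this
        linarith
      simp only at h6
      linarith)
    (fun u => ⟨_, ContinuousMap.const Ω ‖u‖, 0, 0, 0, fun x => norm_nonneg u, fun x => le_rfl,
      le_rfl, le_rfl, fun x y => by
        simpa using (le_abs_self _).trans (u.norm_coe_le_norm (x, y)), le_rfl⟩)
  have hgpos : ∀ u : C(Ω × Ω, ℝ), (∀ x, 0 ≤ u x) → 0 ≤ g u := fun u hu => by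
    have := hg (-u) 0 ⟨0, 0, 0, 0, fun _ => le_rfl, fun _ => le_rfl, le_rfl, le_rfl,
      fun x y => by simpa using hu (x, y), by simp⟩
    rw [map_neg] at this
    linarith
  obtain ⟨π, hπ, hint⟩ := exists_measure_integral_eq g hgpos
  have hfst : π.map Prod.fst ≤ α := measure_le_of_integral_le _ _ fun φ hφ => by
    rw [integral_map measurable_fst.aemeasurable φ.continuous.aestronglyMeasurable]
    refine (hint (φ.comp ⟨Prod.fst, continuous_fst⟩)).trans_le ?_
    exact hg _ _ ⟨φ, 0, 0, 0, hφ, fun _ => le_rfl, le_rfl, le_rfl, fun x y => by simp, by simp⟩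
  have hsnd : π.map Prod.snd ≤ β := measure_le_of_integral_le _ _ fun ψ hψ => by
    rw [integral_map measurable_snd.aemeasurable ψ.continuous.aestronglyMeasurable]
    refine (hint (ψ.comp ⟨Prod.snd, continuous_snd⟩)).trans_le ?_
    exact hg _ _ ⟨0, ψ, 0, 0, fun _ => le_rfl, hψ, le_rfl, le_rfl, fun x y => by simp, by simp⟩
  have hmass : m ≤ π.real Set.univ := by
    have h1 := hg (-1) (-m) ⟨0, 0, 1, 0, fun _ => le_rfl, fun _ => le_rfl, zero_le_one, le_rfl,
      fun x y => by simp, by simp⟩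
    have h2 := hint 1
    simp only [ContinuousMap.one_apply, integral_const, smul_eq_mul, mul_one] at h2
    rw [map_neg] at h1
    linarith
  refine ⟨π, ⟨fun A hA => ?_, fun A hA => ?_, ?_⟩, ?_⟩
  · rw [Set.prod_univ, ← Measure.map_apply measurable_fst hA]
    exact hfst A
  · rw [Set.univ_prod, ← Measure.map_apply measurable_snd hA]
    exact hsnd A
  · exact (ENNReal.ofReal_le_iff_le_toReal (measure_ne_top π _)).2 hmass
  · rw [lintegral_edist_eq_ofReal_integral π]
    refine ENNReal.ofReal_le_ofReal ?_
    refine (hint ⟨fun z => dist z.1 z.2, continuous_dist⟩).trans_le ?_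
    exact hg _ _ ⟨0, 0, 0, 1, fun _ => le_rfl, fun _ => le_rfl, le_rfl, zero_le_one,
      fun x y => by simp, by simp⟩

theorem discrepancy_eq_iSup_functional (m : ℝ) (α β : Measure Ω) [IsFiniteMeasure α]
    [IsFiniteMeasure β] :
    ((discrepancy m α β : ℝ≥0∞) : EReal) =
      ⨆ (f : Ω → ℝ) (h : ℝ) (_ : Admissible f h), ((functional m α β f h : ℝ) : EReal) := by
  refine le_antisymm ?_ (iSup_le fun f => iSup_le fun h => iSup_le functional_le_discrepancy)
  refine EReal.le_of_forall_lt_iff_le.1 fun D hD => ?_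
  have hle : ∀ (f : Ω → ℝ) (h : ℝ), Admissible f h → functional m α β f h ≤ D := fun f h hf =>
    EReal.coe_le_coe_iff.1 <| le_trans (le_iSup_of_le f <| le_iSup_of_le h <|
      le_iSup (fun _ : Admissible f h => ((functional m α β f h : ℝ) : EReal)) hf) hD.le
  have hD0 : 0 ≤ D := by
    simpa [functional] using hle 0 0 ⟨LipschitzWith.const 0 |>.weaken zero_le_one, le_rfl, by simp⟩
  obtain ⟨π, hπ, hcost⟩ := exists_plan_of_functional_le hle
  have : discrepancy m α β ≤ ENNReal.ofReal D := (iInf₂_le π hπ).trans hcost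
  refine (EReal.coe_ennreal_le_coe_ennreal_iff.2 this).trans_eq ?_
  rw [EReal.coe_ennreal_ofReal, max_eq_left hD0]

end Duality

/-! ### Existence of a maximizer -/

theorem admissible_neg_iInf {Ω : Type*} [MetricSpace Ω] [CompactSpace Ω] {f : Ω → ℝ}
    (hlip : LipschitzWith 1 f) (hf : ∀ x, f x ≤ 0) :
    Admissible f (-⨅ x, f x) :=
  ⟨hlip, neg_nonneg.2 (Real.iInf_nonpos hf), fun x => ⟨by
    rw [neg_neg]
    exact ciInf_le (isCompact_range hlip.continuous).bddBelow x, hf x⟩⟩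

theorem Admissible.neg_iInf_le {Ω : Type*} [MetricSpace Ω] {f : Ω → ℝ} {h : ℝ}
    (hf : Admissible f h) : -⨅ x, f x ≤ h := by
  rcases isEmpty_or_nonempty Ω with hΩ | hΩ
  -- an empty infimum of reals is `0`
  · simpa [Real.iInf_of_isEmpty] using hf.2.1
  · exact neg_le.1 (le_ciInf fun x => (hf.2.2 x).1)

theorem functional_anti {Ω : Type*} [MeasurableSpace Ω] {m : ℝ} {α β : Measure Ω}
    (hm : m ≤ β.real Set.univ) (f : Ω → ℝ) {h k : ℝ}
    (hk : k ≤ h) :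
    functional m α β f h ≤ functional m α β f k := by
  have := mul_le_mul_of_nonpos_right hk (sub_nonpos.2 hm)
  unfold functional
  linarith

open scoped BoundedContinuousFunction in
/-- The admissible pairs with `h` bounded form a compact set by the Arzelà–Ascoli theorem. -/
theorem isCompact_setOf_admissible {Ω : Type*} [MetricSpace Ω] [CompactSpace Ω] (R : ℝ) :
    IsCompact {p : (Ω →ᵇ ℝ) × ℝ | Admissible p.1 p.2 ∧ p.2 ≤ R} := by
  have hlip : IsClosed {f : Ω →ᵇ ℝ | LipschitzWith 1 f} := by
    simp only [lipschitzWith_iff_dist_le_mul, Set.ofPred_forall]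
    exact isClosed_iInter fun x => isClosed_iInter fun y =>
      isClosed_le (by fun_prop) continuous_const
  have hK : IsCompact {f : Ω →ᵇ ℝ | LipschitzWith 1 f ∧ ∀ x, f x ∈ Set.Icc (-R) 0} := by
    refine BoundedContinuousFunction.arzela_ascoli₂ (Set.Icc (-R) 0) isCompact_Icc _ ?_
      (fun f x hf => hf.2 x) ?_
    · rw [Set.ofPred_and, Set.ofPred_forall]
      exact hlip.inter (isClosed_iInter fun x => isClosed_Icc.preimage (by fun_prop))
    · exact (LipschitzWith.uniformEquicontinuous _ 1 fun f => f.2.1).equicontinuous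
  refine (hK.prod (isCompact_Icc (a := (0 : ℝ)) (b := R))).of_isClosed_subset ?_ ?_
  · simp only [Admissible, Set.ofPred_and, Set.ofPred_forall]
    refine ((hlip.preimage continuous_fst).inter ((isClosed_le continuous_const
      continuous_snd).inter (isClosed_iInter fun x => ?_))).inter
      (isClosed_le continuous_snd continuous_const)
    exact (isClosed_le (by fun_prop) (by fun_prop)).inter (isClosed_le (by fun_prop) (by fun_prop))
  · rintro ⟨f, h⟩ ⟨⟨h1, h2, h3⟩, h4⟩
    exact ⟨⟨h1, fun x => ⟨by linarith [(h3 x).1], (h3 x).2⟩⟩, h2, h4⟩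

section Maximizer

variable {Ω : Type*} [MetricSpace Ω] [CompactSpace Ω] [MeasurableSpace Ω] [BorelSpace Ω]
  {m : ℝ} {α β : Measure Ω} [IsFiniteMeasure α] [IsFiniteMeasure β]


/-- Translating an admissible pair so that `f` attains the value `0` does not decrease the
functional when `m ≤ m_α`. Lowering `h` to `-inf f` afterwards makes it at most the diameter, and
does not decrease the functional either when `m ≤ m_β`. -/
theorem Admissible.exists_functional_le (hα : m ≤ α.real Set.univ) (hβ : m ≤ β.real Set.univ)
    {f : Ω → ℝ} {h : ℝ} (hf : Admissible f h) :
    ∃ (g : Ω → ℝ) (k : ℝ), Admissible g k ∧ k ≤ Metric.diam (Set.univ : Set Ω) ∧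
      functional m α β f h ≤ functional m α β g k := by
  have hc := hf.1.continuous
  rcases isEmpty_or_nonempty Ω with hΩ | hΩ
  · refine ⟨f, 0, ⟨hf.1, le_rfl, fun x => hΩ.elim x⟩, Metric.diam_nonneg,
      functional_anti hβ f hf.2.1⟩
  · obtain ⟨x₀, hx₀⟩ : ∃ x₀, ∀ x, f x ≤ f x₀ := by
      obtain ⟨x₀, -, h⟩ := isCompact_univ.exists_isMaxOn Set.univ_nonempty hc.continuousOn
      exact ⟨x₀, fun x => h (Set.mem_univ x)⟩
    let g : Ω → ℝ := fun x => f x - f x₀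
    have hg : LipschitzWith 1 g := LipschitzWith.of_le_add fun x y => by
      have := hf.1.dist_le_mul x y
      rw [NNReal.coe_one, one_mul, Real.dist_eq] at this
      have := (le_abs_self _).trans this
      simp only [g]
      linarith
    have hg0 : ∀ x, g x ≤ 0 := fun x => sub_nonpos.2 (hx₀ x)
    have hadm : Admissible g (h + f x₀) :=
      ⟨hg, by linarith [(hf.2.2 x₀).1], fun x => ⟨by simp only [g]; linarith [(hf.2.2 x).1],
        hg0 x⟩⟩
    refine ⟨g, -⨅ x, g x, admissible_neg_iInf hg hg0, ?_, ?_⟩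
    · refine neg_le.1 (le_ciInf fun x => ?_)
      have h1 := hf.1.dist_le_mul x₀ x
      rw [NNReal.coe_one, one_mul, Real.dist_eq] at h1
      have h2 := (le_abs_self _).trans h1
      have h3 := Metric.dist_le_diam_of_mem isCompact_univ.isBounded (Set.mem_univ x₀)
        (Set.mem_univ x)
      simp only [g]
      linarith
    · refine le_trans ?_ (functional_anti hβ g hadm.neg_iInf_le)
      have h0 : 0 ≤ -f x₀ * (α.real Set.univ - m) :=
        mul_nonneg (neg_nonneg.2 (hf.2.2 x₀).2) (sub_nonneg.2 hα)
      simp only [functional, g]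
      rw [integral_sub hc.integrable_of_compactSpace (integrable_const _),
        integral_sub hc.integrable_of_compactSpace (integrable_const _), integral_const,
        integral_const, smul_eq_mul, smul_eq_mul]
      linarith

open scoped BoundedContinuousFunction in
theorem exists_isMaximizer (hα : m ≤ α.real Set.univ) (hβ : m ≤ β.real Set.univ) :
    ∃ (f : Ω → ℝ) (h : ℝ), IsMaximizer m α β f h ∧ h = -⨅ x, f x := by
  have hcont : Continuous fun p : (Ω →ᵇ ℝ) × ℝ => functional m α β p.1 p.2 := by
    have hint : ∀ μ : Measure Ω, IsFiniteMeasure μ → Continuous fun f : Ω →ᵇ ℝ => ∫ x, f x ∂μ :=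
      fun μ _ => (LipschitzWith.of_dist_le_mul (K := (μ Set.univ).toNNReal) fun f g => by
        rw [dist_eq_norm, dist_eq_norm, ← integral_sub (f.integrable μ) (g.integrable μ)]
        exact (f - g).norm_integral_le_mul_norm μ).continuous
    exact (((hint α inferInstance).comp continuous_fst).sub ((hint β inferInstance).comp
      continuous_fst)).add (continuous_snd.mul continuous_const)
  obtain ⟨⟨f, h⟩, ⟨hf, -⟩, hmax⟩ := (isCompact_setOf_admissible (Ω := Ω)
    (Metric.diam (Set.univ : Set Ω))).exists_isMaxOn
    ⟨(0, 0), ⟨⟨LipschitzWith.const 0 |>.weaken zero_le_one, le_rfl, by simp⟩, Metric.diam_nonneg⟩⟩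
    hcont.continuousOn
  refine ⟨f, -⨅ x, f x, ⟨admissible_neg_iInf hf.1 fun x => (hf.2.2 x).2, fun g k hg => ?_⟩, rfl⟩
  obtain ⟨g', k', hg', hk', hle⟩ := hg.exists_functional_le hα hβ
  refine hle.trans (le_trans ?_ (functional_anti hβ f hf.neg_iInf_le))
  exact hmax (show (BoundedContinuousFunction.mkOfCompact ⟨g', hg'.1.continuous⟩, k') ∈ _ from
    ⟨hg', hk'⟩)

theorem IsMaximizer.coe_discrepancy {f : Ω → ℝ} {h : ℝ} (hf : IsMaximizer m α β f h) :
    ((discrepancy m α β : ℝ≥0∞) : EReal) = ((functional m α β f h : ℝ) : EReal) := by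
  rw [discrepancy_eq_iSup_functional]
  exact le_antisymm (iSup_le fun g => iSup_le fun k => iSup_le fun hg =>
    EReal.coe_le_coe_iff.2 (hf.2 g k hg)) (le_iSup_of_le f <| le_iSup_of_le h <|
      le_iSup (fun _ : Admissible f h => ((functional m α β f h : ℝ) : EReal)) hf.1)

theorem IsMaximizer.discrepancy_ne_top {f : Ω → ℝ} {h : ℝ} (hf : IsMaximizer m α β f h) :
    discrepancy m α β ≠ ⊤ := fun H => by
  have := hf.coe_discrepancy
  rw [H, EReal.coe_ennreal_top] at this
  exact EReal.coe_ne_top _ this.symm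

theorem IsMaximizer.toReal_discrepancy {f : Ω → ℝ} {h : ℝ} (hf : IsMaximizer m α β f h) :
    (discrepancy m α β).toReal = functional m α β f h := by
  rw [← EReal.toReal_coe_ennreal, hf.coe_discrepancy, EReal.toReal_coe]

/-- Eliminating `h`: for `m ≤ m_β` the best choice of `h` for a given `f` is `-inf f`. -/
theorem discrepancy_eq_iSup_functional_neg_iInf (hβ : m ≤ β.real Set.univ) :
    ((discrepancy m α β : ℝ≥0∞) : EReal) =
      ⨆ (f : Ω → ℝ) (_ : LipschitzWith 1 f ∧ ∀ x, f x ≤ 0),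
        ((functional m α β f (-⨅ x, f x) : ℝ) : EReal) := by
  rw [discrepancy_eq_iSup_functional]
  refine le_antisymm (iSup_le fun f => iSup_le fun h => iSup_le fun hf => ?_)
    (iSup_le fun f => iSup_le fun hf => ?_)
  · exact le_trans (EReal.coe_le_coe_iff.2 (functional_anti hβ f hf.neg_iInf_le))
      (le_iSup_of_le f <| le_iSup (fun _ : LipschitzWith 1 f ∧ ∀ x, f x ≤ 0 =>
        ((functional m α β f (-⨅ x, f x) : ℝ) : EReal)) ⟨hf.1, fun x => (hf.2.2 x).2⟩)
  · exact le_iSup_of_le f <| le_iSup_of_le (-⨅ x, f x) <| le_iSup (fun _ : Admissible f _ =>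
      ((functional m α β f (-⨅ x, f x) : ℝ) : EReal)) (admissible_neg_iInf hf.1 hf.2)

end Maximizer

/-! ### Differentiation of parametrized integrals -/

section Calculus

variable {E : Type*} [NormedAddCommGroup E] [InnerProductSpace ℝ E] [FiniteDimensional ℝ E]

/-- Rademacher's theorem for locally Lipschitz functions. -/
theorem _root_.LocallyLipschitz.ae_differentiableAt [MeasurableSpace E] [BorelSpace E]
    {μ : Measure E} [μ.IsAddHaarMeasure] {f : E → ℝ} (hf : LocallyLipschitz f) :
    ∀ᵐ x ∂μ, DifferentiableAt ℝ f x := by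
  choose K t ht hlip using hf
  obtain ⟨s, hs, hcover⟩ := TopologicalSpace.countable_cover_nhds
    fun x => interior_mem_nhds.2 (ht x)
  have key := (ae_ball_iff hs).2 fun x _ =>
    ((hlip x).mono interior_subset).ae_differentiableWithinAt_of_mem (μ := μ)
  filter_upwards [key] with y hy
  obtain ⟨x, hx, hyx⟩ := Set.mem_iUnion₂.1 (hcover.symm ▸ Set.mem_univ y)
  exact (hy x hx hyx).differentiableAt (isOpen_interior.mem_nhds hyx)

theorem aestronglyMeasurable_gradient {Y : Type*} [MeasurableSpace Y] {μ : Measure Y}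
    {F : E → Y → ℝ} {x : E} (hF : ∀ v, AEStronglyMeasurable (F v) μ)
    (hd : ∀ᵐ y ∂μ, DifferentiableAt ℝ (F · y) x) :
    AEStronglyMeasurable (fun y => gradient (F · y) x) μ := by
  have hdir : ∀ v : E, AEStronglyMeasurable (fun y => inner ℝ v (gradient (F · y) x)) μ := by
    intro v
    -- the directional derivative is a limit of difference quotients along `1 / n`
    refine aestronglyMeasurable_of_tendsto_ae Filter.atTop
      (f := fun (n : ℕ) y => (n : ℝ) • (F (x + (n : ℝ)⁻¹ • v) y - F x y))
      (fun n => ((hF (x + (n : ℝ)⁻¹ • v)).sub (hF x)).const_smul (n : ℝ)) ?_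
    filter_upwards [hd] with y hy
    have h1 : inner ℝ v (gradient (F · y) x) = fderiv ℝ (F · y) x v := by
      rw [← toDual_gradient, InnerProductSpace.toDual_apply_apply, real_inner_comm]
    rw [h1]
    exact hy.hasFDerivAt.lim v (tendsto_norm_atTop_atTop.comp tendsto_natCast_atTop_atTop)
  have hsum : (fun y => gradient (F · y) x) = fun y => ∑ i, inner ℝ (stdOrthonormalBasis ℝ E i)
      (gradient (F · y) x) • stdOrthonormalBasis ℝ E i := by
    funext y
    exact ((stdOrthonormalBasis ℝ E).sum_repr' _).symm
  rw [hsum]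
  exact Finset.aestronglyMeasurable_fun_sum _ fun i _ => (hdir _).smul_const _

/-- Differentiation under the integral sign for gradients of functions that are Lipschitz near `x`
with a common constant. -/
theorem integrable_gradient_and_hasGradientAt_integral {Y : Type*} [MeasurableSpace Y]
    {μ : Measure Y} [IsFiniteMeasure μ] {F : E → Y → ℝ} {x : E} {s : Set E} (hs : s ∈ 𝓝 x)
    {K : NNReal} (hF : ∀ v, Integrable (F v) μ) (hlip : ∀ y, LipschitzOnWith K (F · y) s)
    (hd : ∀ᵐ y ∂μ, DifferentiableAt ℝ (F · y) x) :
    Integrable (fun y => gradient (F · y) x) μ ∧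
      HasGradientAt (fun v => ∫ y, F v y ∂μ) (∫ y, gradient (F · y) x ∂μ) x := by
  have hmeas := aestronglyMeasurable_gradient (fun v => (hF v).aestronglyMeasurable) hd
  obtain ⟨hint, hderiv⟩ := hasFDerivAt_integral_of_dominated_loc_of_lip
    (F' := fun y => InnerProductSpace.toDual ℝ E (gradient (F · y) x)) (bound := fun _ => (K : ℝ))
    hs (Filter.Eventually.of_forall fun v => (hF v).aestronglyMeasurable) (hF x)
    ((InnerProductSpace.toDual ℝ E).continuous.comp_aestronglyMeasurable hmeas)
    (Filter.Eventually.of_forall fun y => by simpa using hlip y) (integrable_const _)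
    (hd.mono fun y hy => hy.hasGradientAt.hasFDerivAt)
  have hint' : Integrable (fun y => gradient (F · y) x) μ :=
    hint.mono hmeas (Filter.Eventually.of_forall fun y =>
      ((InnerProductSpace.toDual ℝ E).norm_map _).ge)
  refine ⟨hint', hasGradientAt_iff_hasFDerivAt.2 ?_⟩
  have hdual : InnerProductSpace.toDual ℝ E (∫ y, gradient (F · y) x ∂μ)
      = ∫ y, InnerProductSpace.toDual ℝ E (gradient (F · y) x) ∂μ := by
    ext v
    rw [ContinuousLinearMap.integral_apply hint, InnerProductSpace.toDual_apply_apply,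
      real_inner_comm, ← integral_inner hint']
    exact integral_congr_ae (Filter.Eventually.of_forall fun y => by
      simp only [InnerProductSpace.toDual_apply_apply, real_inner_comm])
  rwa [hdual]

end Calculus

/-! ### Dependence on the parameter -/

section Parameter

variable {p : ℕ} {Ω Ω' : Type*} [MetricSpace Ω] [MetricSpace Ω']
  {T : EuclideanSpace ℝ (Fin p) → Ω' → Ω}

theorem LocallyJointlyLipschitz.exists_nnreal (hT : LocallyJointlyLipschitz T)
    (θ₀ : EuclideanSpace ℝ (Fin p)) : ∃ U ∈ 𝓝 θ₀, ∃ K : NNReal, ∀ θ ∈ U, ∀ θ' ∈ U, ∀ y₁ y₂ : Ω',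
      dist (T θ y₁) (T θ' y₂) ≤ K * (dist θ θ' + dist y₁ y₂) := by
  obtain ⟨U, hU, Δ, h⟩ := hT θ₀
  refine ⟨U, hU, Δ.toNNReal, fun θ hθ θ' hθ' y₁ y₂ => (h θ hθ θ' hθ' y₁ y₂).trans ?_⟩
  rw [dist_eq_norm, dist_comm y₁]
  exact mul_le_mul_of_nonneg_right (Real.le_coe_toNNReal Δ) (by positivity)

theorem LocallyJointlyLipschitz.continuous (hT : LocallyJointlyLipschitz T)
    (θ : EuclideanSpace ℝ (Fin p)) : Continuous (T θ) := by
  obtain ⟨U, hU, K, h⟩ := hT.exists_nnreal θ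
  exact (LipschitzWith.of_dist_le_mul (K := K) fun y₁ y₂ => by
    simpa using h θ (mem_of_mem_nhds hU) θ (mem_of_mem_nhds hU) y₁ y₂).continuous

variable [MeasurableSpace Ω] [BorelSpace Ω] [MeasurableSpace Ω'] [BorelSpace Ω']
  {m : ℝ} {α : Measure Ω} {β : Measure Ω'}

theorem functional_map {S : Ω' → Ω} (hS : Continuous S) {f : Ω → ℝ} (hf : Continuous f) (h : ℝ) :
    functional m α (β.map S) f h
      = ∫ x, f x ∂α - ∫ y, f (S y) ∂β + h * (m - β.real Set.univ) := by
  rw [functional, integral_map hS.measurable.aemeasurable hf.aestronglyMeasurable,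
    map_measureReal_apply hS.measurable MeasurableSet.univ, Set.preimage_univ]

variable [CompactSpace Ω] [IsFiniteMeasure α] [IsFiniteMeasure β]

theorem functional_le_objective (hα : m ≤ α.real Set.univ) (hβ : m ≤ β.real Set.univ)
    (hT : LocallyJointlyLipschitz T) {f : Ω → ℝ} {h : ℝ} (hf : Admissible f h)
    (θ : EuclideanSpace ℝ (Fin p)) :
    functional m α (β.map (T θ)) f h ≤ objective m α β T θ := by
  have hβ' : m ≤ (β.map (T θ)).real Set.univ := by
    rwa [map_measureReal_apply (hT.continuous θ).measurable MeasurableSet.univ,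
      Set.preimage_univ]
  obtain ⟨g, k, hg, -⟩ := exists_isMaximizer hα hβ'
  rw [objective, hg.toReal_discrepancy]
  exact hg.2 f h hf

theorem exists_isMaximizer_map (hα : m ≤ α.real Set.univ) (hβ : m ≤ β.real Set.univ)
    (hT : LocallyJointlyLipschitz T) (θ : EuclideanSpace ℝ (Fin p)) :
    ∃ (f : Ω → ℝ) (h : ℝ), IsMaximizer m α (β.map (T θ)) f h := by
  obtain ⟨g, k, hg, -⟩ := exists_isMaximizer (m := m) (β := β.map (T θ)) hα (by
    rwa [map_measureReal_apply (hT.continuous θ).measurable MeasurableSet.univ,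
      Set.preimage_univ])
  exact ⟨g, k, hg⟩

theorem locallyLipschitz_objective [CompactSpace Ω'] (hα : m ≤ α.real Set.univ)
    (hβ : m ≤ β.real Set.univ) (hT : LocallyJointlyLipschitz T) :
    LocallyLipschitz (objective m α β T) := by
  intro θ₀
  obtain ⟨U, hU, K, h⟩ := hT.exists_nnreal θ₀
  refine ⟨K * (β Set.univ).toNNReal, U, hU, LipschitzOnWith.of_le_add_mul _ fun θ hθ θ' hθ' => ?_⟩
  -- test the objective at `θ'` against a maximizer for `θ`
  obtain ⟨f, k, hf⟩ := exists_isMaximizer_map hα hβ hT θ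
  have hc := hf.1.1.continuous
  have h1 := functional_le_objective hα hβ hT hf.1 θ'
  have h2 : objective m α β T θ = functional m α (β.map (T θ)) f k := hf.toReal_discrepancy
  rw [functional_map (hT.continuous _) hc] at h1 h2
  have hi : ∀ ϑ, Integrable (fun y => f (T ϑ y)) β := fun ϑ =>
    (hc.comp (hT.continuous ϑ)).integrable_of_compactSpace
  have h3 : ∫ y, (f (T θ' y) - f (T θ y)) ∂β ≤ ∫ _, (K : ℝ) * dist θ θ' ∂β := by
    refine integral_mono ((hi θ').sub (hi θ)) (integrable_const _) fun y => ?_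
    have h4 := hf.1.1.dist_le_mul (T θ' y) (T θ y)
    rw [NNReal.coe_one, one_mul, Real.dist_eq, dist_comm] at h4
    have h5 := h θ hθ θ' hθ' y y
    rw [dist_self, add_zero] at h5
    exact (le_abs_self _).trans (h4.trans h5)
  rw [integral_sub (hi θ') (hi θ), integral_const, smul_eq_mul] at h3
  have h6 : ((K * (β Set.univ).toNNReal : NNReal) : ℝ) = K * β.real Set.univ := rfl
  rw [h6]
  linarith

/-- The envelope theorem for the dual problem: a maximizer `(f, h)` at `θ` gives a minorant of the
objective that touches it at `θ`, so the two have the same gradient there. -/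
theorem integrable_gradient_and_gradient_objective [CompactSpace Ω'] (hα : m ≤ α.real Set.univ)
    (hβ : m ≤ β.real Set.univ) (hT : LocallyJointlyLipschitz T) {θ : EuclideanSpace ℝ (Fin p)}
    {f : Ω → ℝ} {h : ℝ} (hf : IsMaximizer m α (β.map (T θ)) f h)
    (hobj : DifferentiableAt ℝ (objective m α β T) θ)
    (hd : ∀ᵐ y ∂β, DifferentiableAt ℝ (fun ϑ => f (T ϑ y)) θ) :
    Integrable (fun y => gradient (fun ϑ => f (T ϑ y)) θ) β ∧
      gradient (objective m α β T) θ = -∫ y, gradient (fun ϑ => f (T ϑ y)) θ ∂β := by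
  have hc := hf.1.1.continuous
  obtain ⟨U, hU, K, hK⟩ := hT.exists_nnreal θ
  obtain ⟨hint, hgrad⟩ := integrable_gradient_and_hasGradientAt_integral (μ := β)
    (F := fun ϑ y => f (T ϑ y)) hU (K := K)
    (fun ϑ => (hc.comp (hT.continuous ϑ)).integrable_of_compactSpace)
    (fun y => LipschitzOnWith.of_dist_le_mul fun ϑ hϑ ϑ' hϑ' => by
      have h1 := hf.1.1.dist_le_mul (T ϑ y) (T ϑ' y)
      rw [NNReal.coe_one, one_mul] at h1
      simpa using h1.trans (hK ϑ hϑ ϑ' hϑ' y y)) hd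
  refine ⟨hint, ?_⟩
  have hmin : IsLocalMin (fun ϑ => objective m α β T ϑ + ∫ y, f (T ϑ y) ∂β) θ := by
    refine Filter.Eventually.of_forall fun ϑ => ?_
    have h1 := functional_le_objective hα hβ hT hf.1 ϑ
    have h2 : objective m α β T θ = functional m α (β.map (T θ)) f h := hf.toReal_discrepancy
    rw [functional_map (hT.continuous _) hc] at h1 h2
    change objective m α β T θ + _ ≤ objective m α β T ϑ + _
    linarith
  have hzero := hmin.hasFDerivAt_eq_zero (hobj.hasGradientAt.hasFDerivAt.add hgrad.hasFDerivAt)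
  rw [← map_add, map_eq_zero_iff _ (InnerProductSpace.toDual ℝ _).injective] at hzero
  exact eq_neg_of_add_eq_zero_left hzero

end Parameter

end PartialWasserstein

theorem theorem2 {Ω Ω' : Type*}
    [MetricSpace Ω] [CompactSpace Ω] [MeasurableSpace Ω] [BorelSpace Ω]
    [MetricSpace Ω'] [CompactSpace Ω'] [MeasurableSpace Ω'] [BorelSpace Ω']
    (α : Measure Ω) [IsFiniteMeasure α] (m : ℝ) (hm : 0 ≤ m) :
    -- duality and existence of a maximizer
    (∀ (β : Measure Ω) [IsFiniteMeasure β],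
      ((PartialWasserstein.discrepancy m α β : ℝ≥0∞) : EReal) =
          ⨆ (f : Ω → ℝ) (h : ℝ) (_ : PartialWasserstein.Admissible f h),
            ((PartialWasserstein.functional m α β f h : ℝ) : EReal) ∧
      (m ≤ α.real Set.univ → m ≤ β.real Set.univ →
        PartialWasserstein.discrepancy m α β ≠ ⊤ ∧
        ((PartialWasserstein.discrepancy m α β : ℝ≥0∞) : EReal) =
          ⨆ (f : Ω → ℝ) (_ : LipschitzWith 1 f ∧ ∀ x, f x ≤ 0),
            ((PartialWasserstein.functional m α β f (-⨅ x, f x) : ℝ) : EReal) ∧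
        ∃ (f : Ω → ℝ) (h : ℝ),
          PartialWasserstein.IsMaximizer m α β f h ∧ h = -⨅ x, f x)) ∧
    -- regularity in the parameter and the gradient formula
    (∀ (β : Measure Ω') [IsFiniteMeasure β],
      m ≤ α.real Set.univ → m ≤ β.real Set.univ →
      ∀ (p : ℕ) (T : EuclideanSpace ℝ (Fin p) → Ω' → Ω),
        PartialWasserstein.LocallyJointlyLipschitz T →
        Continuous (PartialWasserstein.objective m α β T) ∧
        LocallyLipschitz (PartialWasserstein.objective m α β T) ∧
        (∀ᵐ θ, DifferentiableAt ℝ (PartialWasserstein.objective m α β T) θ) ∧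
        ∀ (θ : EuclideanSpace ℝ (Fin p)) (f : Ω → ℝ) (h : ℝ),
          PartialWasserstein.IsMaximizer m α (β.map (T θ)) f h →
          DifferentiableAt ℝ (PartialWasserstein.objective m α β T) θ →
          (∀ᵐ y ∂β, DifferentiableAt ℝ (fun ϑ => f (T ϑ y)) θ) →
          Integrable (fun y => gradient (fun ϑ => f (T ϑ y)) θ) β ∧
          gradient (PartialWasserstein.objective m α β T) θ =
            -∫ y, gradient (fun ϑ => f (T ϑ y)) θ ∂β) := by
  refine ⟨fun β _ => ⟨PartialWasserstein.discrepancy_eq_iSup_functional m α β, fun hα hβ => ?_⟩,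
    fun β _ hα hβ p T hT => ?_⟩
  · obtain ⟨f, h, hf, hh⟩ := PartialWasserstein.exists_isMaximizer hα hβ
    exact ⟨hf.discrepancy_ne_top,
      PartialWasserstein.discrepancy_eq_iSup_functional_neg_iInf hβ, f, h, hf, hh⟩
  · have hlip := PartialWasserstein.locallyLipschitz_objective hα hβ hT
    exact ⟨hlip.continuous, hlip, hlip.ae_differentiableAt, fun θ f h hf hobj hd =>
      PartialWasserstein.integrable_gradient_and_gradient_objective hα hβ hT hf hobj hd⟩
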